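/- Let $X$ be a real Banach space with topological dual $X^*$, let $f\colon X\to\mathbb{R}\cup\{+\infty\}$ be a closed (i.e. lower semicontinuous) convex function, and let $x\in\operatorname{dom} f=\{y\in X : f(y)\in\mathbb{R}\}$. Call $f$ hypodifferentiable at $x$ if there is a set $H\subset\mathbb{R}\times X^*$, compact in the product of the usual topology of $\mathbb{R}$ and the weak$^*$ topology of $X^*$, such that $\max_{(a,x^*)\in H} a=0$ and, for every $u\in X$, $$\lim_{\alpha\to+0}\frac1\alpha\Big|f(x+\alpha u)-f(x)-\max_{(a,x^*)\in H}\big(a+\alpha\langle x^*,u\rangle\big)\Big|=0 .$$ For $Q\subseteq X$ let $\operatorname{core} Q$ be the set of all $z\in Q$ such that for every $y\in X$ there is $t_y>0$ with $z+ty\in Q$ for all $t\in[0,t_y]$. Let $\partial f(x)=\{x^*\in X^* : f(y)\ge f(x)+\langle x^*,y-x\rangle\ \text{for all } y\in X\}$ be the subdifferential, and let $f'(x,u)=\lim_{\alpha\to+0}\big(f(x+\alpha u)-f(x)\big)/\alpha\in[-\infty,+\infty]$ be the directional derivative. Then $f$ is hypodifferentiable at $x$ if and only if the following four conditions hold: (i)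 $x\in\operatorname{core}\operatorname{dom} f$; (ii) $\partial f(x)\neq\emptyset$; (iii) $\partial f(x)$ is weak$^*$ compact; (iv) the function $f'(x,\cdot)$ is lower semicontinuous on $X$. Moreover, if $X$ is finite dimensional, then condition (iv) is redundant: (i) implies (iv), and hence $f$ is hypodifferentiable at $x$ if and only if (i), (ii) and (iii) hold. -/

import Mathlib

noncomputable section

open Set Filter Topology

namespace Hypodiff

variable {X : Type*} [NormedAddCommGroup X] [NormedSpace ℝ X]

/-- `f : X → ℝ ∪ {+∞}` is a closed convex function: it never takes the value `-∞`,
its epigraph is convex, and it is lower semicontinuous. -/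
structure IsClosedConvex (f : X → EReal) : Prop where
  ne_bot : ∀ x, f x ≠ ⊥
  convex_epigraph : Convex ℝ {p : X × ℝ | f p.1 ≤ (p.2 : EReal)}
  lsc : LowerSemicontinuous f

/-- The effective domain `{x | f x ∈ ℝ}`. -/
def dom (f : X → EReal) : Set X := {x | ∃ r : ℝ, f x = (r : EReal)}

/-- The algebraic interior (radial kernel) of `Q`. -/
def core (Q : Set X) : Set X :=
  {x | x ∈ Q ∧ ∀ y : X, ∃ τ : ℝ, 0 < τ ∧ ∀ t ∈ Icc (0 : ℝ) τ, x + t • y ∈ Q}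

/-- The subdifferential of `f` at `x`, as a subset of the dual space with its weak* topology. -/
def subdiff (f : X → EReal) (x : X) : Set (WeakDual ℝ X) :=
  {φ | ∀ y : X, f x + ((φ (y - x) : ℝ) : EReal) ≤ f y}

/-- The difference quotient `(f (x + α u) - f x) / α`. -/
def diffQuot (f : X → EReal) (x u : X) (α : ℝ) : EReal :=
  (f (x + α • u) - f x) / (α : EReal)

/-- The directional derivative `f'(x, u)`, the limit of the difference quotient as `α → +0`,
with values in `[-∞, +∞]`. The limit exists for convex `f` and `x ∈ dom f`, see
`tendsto_diffQuot`. -/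
def dirDeriv (f : X → EReal) (x u : X) : EReal :=
  limUnder (𝓝[>] (0 : ℝ)) (diffQuot f x u)

/-- The maximum of `a + α ⟨φ, u⟩` over `(a, φ) ∈ H`. It is attained for nonempty weak* compact
`H`, see `isGreatest_maxAffine`. -/
def maxAffine (H : Set (ℝ × WeakDual ℝ X)) (α : ℝ) (u : X) : ℝ :=
  sSup ((fun p : ℝ × WeakDual ℝ X => p.1 + α * p.2 u) '' H)

/-- `H ⊆ ℝ × X*` is a hypodifferential of `f` at `x`. The topology on `ℝ × WeakDual ℝ X` is the
product of the usual topology of `ℝ` and the weak* topology. The absolute value is taken in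
`[0, +∞]`, so it is `+∞` where `f (x + α u) = +∞`. -/
structure IsHypodifferential (f : X → EReal) (x : X) (H : Set (ℝ × WeakDual ℝ X)) : Prop where
  isCompact : IsCompact H
  tendsto : ∀ u : X,
    Tendsto
      (fun α : ℝ =>
        (f (x + α • u) - f x - ((maxAffine H α u : ℝ) : EReal)).abs / ENNReal.ofReal α)
      (𝓝[>] (0 : ℝ)) (𝓝 0)
  max_eq_zero : IsGreatest (Prod.fst '' H) 0

/-- `f` is hypodifferentiable at `x`. -/
def HypodifferentiableAt (f : X → EReal) (x : X) : Prop :=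
  ∃ H : Set (ℝ × WeakDual ℝ X), IsHypodifferential f x H

theorem isGreatest_maxAffine {H : Set (ℝ × WeakDual ℝ X)} (hH : IsCompact H) (hne : H.Nonempty)
    (α : ℝ) (u : X) :
    IsGreatest ((fun p : ℝ × WeakDual ℝ X => p.1 + α * p.2 u) '' H) (maxAffine H α u) := by
  have hc : Continuous (fun p : ℝ × WeakDual ℝ X => p.1 + α * p.2 u) :=
    continuous_fst.add (continuous_const.mul ((WeakDual.eval_continuous u).comp continuous_snd))
  exact (hH.image hc).isGreatest_sSup (hne.image _)

theorem tendsto_diffQuot {f : X → EReal} (hf : IsClosedConvex f) {x : X} (hx : x ∈ dom f)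
    (u : X) : Tendsto (diffQuot f x u) (𝓝[>] (0 : ℝ)) (𝓝 (dirDeriv f x u)) := by
  obtain ⟨r, hr⟩ := hx
  have hmono : MonotoneOn (diffQuot f x u) (Ioi 0) := by
    intro s hs t ht hst
    have hs' : (0 : ℝ) < s := hs
    have ht' : (0 : ℝ) < t := ht
    unfold diffQuot
    rw [hr]
    induction hb : f (x + t • u) with
    | bot => exact absurd hb (hf.ne_bot _)
    | top =>
      rw [EReal.top_sub_coe, EReal.top_div_of_pos_ne_top (by exact_mod_cast ht')
        (EReal.coe_ne_top _)]
      exact le_top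
    | coe b =>
      have key := hf.convex_epigraph
        (show (x + t • u, b) ∈ {p : X × ℝ | f p.1 ≤ (p.2 : EReal)} from hb.le)
        (show (x, r) ∈ {p : X × ℝ | f p.1 ≤ (p.2 : EReal)} from hr.le)
        (show (0 : ℝ) ≤ s / t by positivity)
        (show (0 : ℝ) ≤ 1 - s / t by
          rw [sub_nonneg]; exact (div_le_one ht').2 hst) (by ring)
      have hpt : (s / t) • (x + t • u) + (1 - s / t) • x = x + s • u := by
        rw [smul_add, smul_smul, div_mul_cancel₀ _ ht'.ne', sub_smul, one_smul]
        abel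
      simp only [Prod.smul_mk, Prod.mk_add_mk, mem_ofPred_eq, hpt, smul_eq_mul] at key
      induction hc : f (x + s • u) with
      | bot => exact absurd hc (hf.ne_bot _)
      | top => rw [hc] at key; exact absurd (top_le_iff.1 key) (EReal.coe_ne_top _)
      | coe c =>
        rw [hc] at key
        have key' : c ≤ s / t * b + (1 - s / t) * r := by exact_mod_cast key
        have : (c - r) / s ≤ (b - r) / t := by
          rw [div_le_iff₀ hs']
          have : (b - r) / t * s = s / t * b + (1 - s / t) * r - r := by field_simp; ring
          linarith
        rw [← EReal.coe_sub, ← EReal.coe_sub, ← EReal.coe_div, ← EReal.coe_div]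
        exact EReal.coe_le_coe_iff.2 this
  exact tendsto_nhds_limUnder ⟨_, hmono.tendsto_nhdsGT (OrderBot.bddBelow _)⟩

end Hypodiff

end

open Set Filter Topology

namespace Hypodiff

variable {X : Type*} [NormedAddCommGroup X] [NormedSpace ℝ X] {f : X → EReal} {x : X}

/-! On a Banach space condition (i) alone yields (ii)–(iv) and hypodifferentiability, so finite
dimension plays no role. By Baire, `f` is bounded above on a ball around a core point `x`; convexity
turns this into `|f (x + u) - f x| ≤ K‖u‖` near `0`. Hence the directional derivative `p` is finite,
sublinear and at most `K‖·‖`, thus continuous. Hahn–Banach makes `p` the attained support function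
of the subdifferential, Banach–Alaoglu makes that set weak* compact, and `{0} × ∂f(x)` is a
hypodifferential because its affine maximum is `α * p u`. Conversely, the limit defining a
hypodifferential forces `f` to be finite near `x` along every ray, which is (i). -/

theorem IsClosedConvex.le_combo (hf : IsClosedConvex f) {u v : X} {a b s t : ℝ}
    (hu : f (x + u) ≤ a) (hv : f (x + v) ≤ b) (hs : 0 ≤ s) (ht : 0 ≤ t) (hst : s + t = 1) :
    f (x + (s • u + t • v)) ≤ ((s * a + t * b : ℝ) : EReal) := by
  have key := hf.convex_epigraph
    (show (x + u, a) ∈ {p : X × ℝ | f p.1 ≤ (p.2 : EReal)} from hu)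
    (show (x + v, b) ∈ {p : X × ℝ | f p.1 ≤ (p.2 : EReal)} from hv) hs ht hst
  have hpt : s • (x + u) + t • (x + v) = x + (s • u + t • v) := by
    have : (s + t) • x = x := by rw [hst, one_smul]
    rw [smul_add, smul_add]
    nth_rewrite 3 [← this]
    rw [add_smul]
    abel
  simpa only [Prod.smul_mk, Prod.mk_add_mk, mem_ofPred_eq, hpt, smul_eq_mul] using key

theorem IsClosedConvex.le_smul (hf : IsClosedConvex f) {u : X} {a r s : ℝ} (hr : f x = r)
    (hu : f (x + u) ≤ a) (hs : 0 ≤ s) (hs1 : s ≤ 1) :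
    f (x + s • u) ≤ ((s * a + (1 - s) * r : ℝ) : EReal) := by
  have h0 : f (x + 0) ≤ (r : EReal) := by rw [add_zero, hr]
  simpa using hf.le_combo hu h0 hs (sub_nonneg.2 hs1) (by ring)

theorem IsClosedConvex.coe_toReal (hf : IsClosedConvex f) {y : X} {a : ℝ} (hy : f y ≤ a) :
    ((f y).toReal : EReal) = f y :=
  EReal.coe_toReal (ne_top_of_le_ne_top (EReal.coe_ne_top a) hy) (hf.ne_bot y)

/-! ### Baire category and local bounds -/

/-- A closed convex function on a Banach space is bounded above near any point of the core of its
domain. -/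
theorem IsClosedConvex.exists_le_of_mem_core [CompleteSpace X] (hf : IsClosedConvex f)
    (hx : x ∈ core (dom f)) :
    ∃ δ > (0 : ℝ), ∃ M : ℝ, ∀ u : X, ‖u‖ ≤ δ → f (x + u) ≤ (M : EReal) := by
  obtain ⟨⟨r, hr⟩, hcore⟩ := hx
  let c : ℕ → ℝ := fun n => ((n : ℝ) + 1)⁻¹
  have hc : ∀ n, 0 < c n := fun n => by positivity
  -- Both signs are imposed so that `-w` can cancel the unknown centre `w` of a ball inside some `B
  -- n`.
  let B : ℕ → Set X := fun n =>
    {u | f (x + c n • u) ≤ ((n : ℝ) : EReal) ∧ f (x + c n • -u) ≤ ((n : ℝ) : EReal)}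
  have hclosed : ∀ n, IsClosed (B n) := fun n =>
    ((hf.lsc.isClosed_preimage ((n : ℝ) : EReal)).preimage
      (by fun_prop : Continuous fun u : X => x + c n • u)).inter
    ((hf.lsc.isClosed_preimage ((n : ℝ) : EReal)).preimage
      (by fun_prop : Continuous fun u : X => x + c n • -u))
  have hev : ∀ u : X, ∀ᶠ n : ℕ in atTop, f (x + c n • u) ≤ ((n : ℝ) : EReal) := by
    intro u
    obtain ⟨τ, hτ, h⟩ := hcore u
    obtain ⟨a, ha⟩ := h τ ⟨hτ.le, le_rfl⟩
    have hlim : Tendsto c atTop (𝓝 0) := by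
      simpa [c, one_div] using tendsto_one_div_add_atTop_nhds_zero_nat (𝕜 := ℝ)
    filter_upwards [hlim.eventually (gt_mem_nhds hτ),
      tendsto_natCast_atTop_atTop.eventually_ge_atTop a,
      tendsto_natCast_atTop_atTop.eventually_ge_atTop r] with n h1 h2 h3
    have hle : c n / τ ≤ 1 := (div_le_one hτ).2 h1.le
    have hnn : 0 ≤ c n / τ := (div_pos (hc n) hτ).le
    have := hf.le_smul hr ha.le hnn hle
    rw [smul_smul, div_mul_cancel₀ _ hτ.ne'] at this
    refine this.trans (EReal.coe_le_coe_iff.2 ?_)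
    nlinarith
  have hcover : ⋃ n, B n = univ := by
    refine eq_univ_of_forall fun u => ?_
    obtain ⟨n, hn⟩ := ((hev u).and (hev (-u))).exists
    exact mem_iUnion.2 ⟨n, hn⟩
  obtain ⟨n, w, hw⟩ := nonempty_interior_of_iUnion_of_closed hclosed hcover
  obtain ⟨ε, hε, hball⟩ := Metric.mem_nhds_iff.1 (mem_interior_iff_mem_nhds.1 hw)
  refine ⟨c n * (ε / 4), mul_pos (hc n) (by positivity), n, fun u hu => ?_⟩
  -- The factor `2 / c n` makes `u` the midpoint of `c n • (w + (2 / c n) • u)` and `c n • -w`; the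
  -- radius `c n * (ε / 4)` keeps the shift at most `ε / 2`.
  have hmem : w + (2 * (c n)⁻¹) • u ∈ B n := by
    apply hball
    rw [Metric.mem_ball, dist_eq_norm, add_sub_cancel_left, norm_smul, Real.norm_eq_abs,
      abs_of_pos (mul_pos two_pos (inv_pos.2 (hc n)))]
    calc 2 * (c n)⁻¹ * ‖u‖ ≤ 2 * (c n)⁻¹ * (c n * (ε / 4)) := by
          gcongr
      _ = ε / 2 := by field_simp [(hc n).ne']; ring
      _ < ε := by linarith
  have hwB : w ∈ B n := hball (Metric.mem_ball_self hε)
  have := hf.le_combo hmem.1 hwB.2 (s := 1 / 2) (t := 1 / 2) (by norm_num) (by norm_num)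
    (by norm_num)
  have hpt : (1 / 2 : ℝ) • c n • (w + (2 * (c n)⁻¹) • u) + (1 / 2 : ℝ) • c n • -w = u := by
    have h1 : (1 / 2 : ℝ) * (c n * (2 * (c n)⁻¹)) = 1 := by field_simp [(hc n).ne']
    rw [smul_add, smul_add, smul_smul (c n), smul_smul (1 / 2 : ℝ) (c n * _), h1, one_smul,
      smul_neg, smul_neg]
    abel
  rw [hpt] at this
  refine this.trans (EReal.coe_le_coe_iff.2 ?_)
  linarith

/-- If a convex function is bounded above near `x`, its increments at `x` are bounded linearly. -/
theorem IsClosedConvex.exists_abs_sub_le (hf : IsClosedConvex f) {r : ℝ} (hr : f x = r)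
    {δ M : ℝ} (hδ : 0 < δ) (hM : ∀ u : X, ‖u‖ ≤ δ → f (x + u) ≤ (M : EReal)) :
    ∃ K : ℝ, 0 ≤ K ∧ ∀ u : X, ‖u‖ ≤ δ → |(f (x + u)).toReal - r| ≤ K * ‖u‖ := by
  have hrM : r ≤ M := by
    have := hM 0 (by simpa using hδ.le)
    rw [add_zero, hr] at this
    exact EReal.coe_le_coe_iff.1 this
  have hreal : ∀ u : X, ‖u‖ ≤ δ → f (x + u) = ((f (x + u)).toReal : EReal) :=
    fun u hu => (hf.coe_toReal (hM u hu)).symm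
  have hupper : ∀ u : X, ‖u‖ ≤ δ → (f (x + u)).toReal - r ≤ (M - r) / δ * ‖u‖ := by
    intro u hu
    rcases eq_or_ne u 0 with rfl | hu0
    · simp [hr]
    have hn : 0 < ‖u‖ := norm_pos_iff.2 hu0
    -- Stretch `u` to the sphere of radius `δ`, use `M` there, and interpolate back towards `x`.
    have hv : ‖(δ / ‖u‖) • u‖ ≤ δ := by
      rw [norm_smul, Real.norm_eq_abs, abs_of_pos (div_pos hδ hn), div_mul_cancel₀ _ hn.ne']
    have := hf.le_smul hr (hM _ hv) (s := ‖u‖ / δ) (by positivity) ((div_le_one hδ).2 hu)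
    have h1 : ‖u‖ / δ * (δ / ‖u‖) = 1 := by field_simp
    rw [smul_smul, h1, one_smul, hreal u hu, EReal.coe_le_coe_iff] at this
    have h2 : (M - r) / δ * ‖u‖ = ‖u‖ / δ * M + (1 - ‖u‖ / δ) * r - r := by field_simp; ring
    linarith
  refine ⟨(M - r) / δ, div_nonneg (sub_nonneg.2 hrM) hδ.le, fun u hu => abs_le.2 ⟨?_, hupper u hu⟩⟩
  -- Since `x` is the midpoint of `x + u` and `x - u`, the upper bound at `-u` gives the lower bound
  -- at `u`.
  have hu' : ‖-u‖ ≤ δ := by rwa [norm_neg]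
  have h1 := hupper (-u) hu'
  have h2 := hf.le_combo (hreal u hu).le (hreal (-u) hu').le (s := 1 / 2) (t := 1 / 2)
    (by norm_num) (by norm_num) (by norm_num)
  rw [smul_neg, add_neg_cancel, add_zero, hr, EReal.coe_le_coe_iff] at h2
  rw [norm_neg] at h1
  linarith

/-! ### The directional derivative as a sublinear function -/

theorem eventually_norm_smul_le (u : X) {δ : ℝ} (hδ : 0 < δ) :
    ∀ᶠ α : ℝ in 𝓝[>] 0, ‖α • u‖ ≤ δ := by
  have : Tendsto (fun α : ℝ => ‖α • u‖) (𝓝[>] 0) (𝓝 0) := by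
    have h : Continuous fun α : ℝ => ‖α • u‖ := by fun_prop
    simpa using (h.tendsto 0).mono_left nhdsWithin_le_nhds
  exact this.eventually_le_const hδ

/-- `p` is the real-valued sublinear directional derivative of `f` at `x`, bounded by `K‖·‖`. -/
structure IsSublinearDeriv (f : X → EReal) (x : X) (K : ℝ) (p : X → ℝ) : Prop where
  dirDeriv_eq : ∀ u, dirDeriv f x u = p u
  eventually_real : ∀ u, ∀ᶠ α : ℝ in 𝓝[>] 0, f (x + α • u) = ((f (x + α • u)).toReal : EReal)
  tendsto : ∀ u, Tendsto (fun α : ℝ => ((f (x + α • u)).toReal - (f x).toReal) / α) (𝓝[>] 0)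
    (𝓝 (p u))
  bound : ∀ u, p u ≤ K * ‖u‖
  homogeneous : ∀ c : ℝ, 0 < c → ∀ u, p (c • u) = c * p u
  subadditive : ∀ u v, p (u + v) ≤ p u + p v

theorem IsClosedConvex.exists_isSublinearDeriv (hf : IsClosedConvex f) (hx : x ∈ dom f)
    {δ M : ℝ} (hδ : 0 < δ) (hM : ∀ u : X, ‖u‖ ≤ δ → f (x + u) ≤ (M : EReal)) :
    ∃ K p, 0 ≤ K ∧ IsSublinearDeriv f x K p := by
  have htend := tendsto_diffQuot hf hx
  obtain ⟨r, hr⟩ := hx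
  obtain ⟨K, hK, hbound⟩ := hf.exists_abs_sub_le hr hδ hM
  have hreal : ∀ u, ∀ᶠ α : ℝ in 𝓝[>] 0, f (x + α • u) = ((f (x + α • u)).toReal : EReal) :=
    fun u => (eventually_norm_smul_le u hδ).mono fun α h => (hf.coe_toReal (hM _ h)).symm
  let q : X → ℝ → ℝ := fun u α => ((f (x + α • u)).toReal - (f x).toReal) / α
  have hq : ∀ u, ∀ᶠ α : ℝ in 𝓝[>] 0, diffQuot f x u α = (q u α : EReal) := by
    intro u
    filter_upwards [hreal u] with α h
    simp only [diffQuot, q]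
    rw [h, hr, EReal.toReal_coe, EReal.toReal_coe, ← EReal.coe_sub, ← EReal.coe_div]
  have hqb : ∀ u, ∀ᶠ α : ℝ in 𝓝[>] 0, |q u α| ≤ K * ‖u‖ := by
    intro u
    filter_upwards [eventually_norm_smul_le u hδ, self_mem_nhdsWithin] with α h hα
    have hα : (0 : ℝ) < α := hα
    have := hbound _ h
    rw [norm_smul, Real.norm_eq_abs, abs_of_pos hα] at this
    simp only [q]
    rw [hr, EReal.toReal_coe, abs_div, abs_of_pos hα, div_le_iff₀ hα]
    linarith
  have hle : ∀ u, dirDeriv f x u ≤ ((K * ‖u‖ : ℝ) : EReal) := fun u =>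
    le_of_tendsto (htend u) <| by
      filter_upwards [hq u, hqb u] with α h1 h2
      rw [h1]
      exact EReal.coe_le_coe_iff.2 (abs_le.1 h2).2
  have hge : ∀ u, ((-(K * ‖u‖) : ℝ) : EReal) ≤ dirDeriv f x u := fun u =>
    ge_of_tendsto (htend u) <| by
      filter_upwards [hq u, hqb u] with α h1 h2
      rw [h1]
      exact EReal.coe_le_coe_iff.2 (abs_le.1 h2).1
  have hcoe : ∀ u, dirDeriv f x u = ((dirDeriv f x u).toReal : EReal) := fun u =>
    (EReal.coe_toReal (ne_top_of_le_ne_top (EReal.coe_ne_top _) (hle u))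
      (ne_bot_of_le_ne_bot (EReal.coe_ne_bot _) (hge u))).symm
  have hlim : ∀ u, Tendsto (q u) (𝓝[>] 0) (𝓝 (dirDeriv f x u).toReal) := by
    intro u
    rw [← EReal.tendsto_coe, ← hcoe u]
    exact (htend u).congr' (hq u)
  have hscale : ∀ c : ℝ, 0 < c → Tendsto (fun α : ℝ => c * α) (𝓝[>] 0) (𝓝[>] 0) := by
    intro c hc
    refine tendsto_nhdsWithin_iff.2 ⟨?_, ?_⟩
    · have h : Continuous fun α : ℝ => c * α := by fun_prop
      simpa using (h.tendsto 0).mono_left nhdsWithin_le_nhds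
    · filter_upwards [self_mem_nhdsWithin] with α hα
      exact mul_pos hc hα
  refine ⟨K, fun u => (dirDeriv f x u).toReal, hK, hcoe, hreal, hlim, fun u => ?_, ?_, ?_⟩
  · have := hle u
    rw [hcoe u] at this
    exact EReal.coe_le_coe_iff.1 this
  · intro c hc u
    refine tendsto_nhds_unique (hlim (c • u)) ?_
    refine (((hlim u).comp (hscale c hc)).const_mul c).congr' ?_
    filter_upwards [self_mem_nhdsWithin] with α hα
    have hα : (0 : ℝ) < α := hα
    simp only [q, Function.comp]
    rw [smul_smul, mul_comm α c]
    field_simp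
  -- `α • (u + v)` is the midpoint of `2α • u` and `2α • v`, so the quotients of `u` and `v` are
  -- taken at step `2α`.
  · intro u v
    refine le_of_tendsto_of_tendsto (hlim (u + v))
      (((hlim u).comp (hscale 2 two_pos)).add ((hlim v).comp (hscale 2 two_pos))) ?_
    filter_upwards [hreal (u + v), (hscale 2 two_pos).eventually (hreal u),
      (hscale 2 two_pos).eventually (hreal v), self_mem_nhdsWithin] with α h1 h2 h3 hα
    have hα : (0 : ℝ) < α := hα
    have key := hf.le_combo h2.le h3.le (s := 1 / 2) (t := 1 / 2) (by norm_num) (by norm_num)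
      (by norm_num)
    have hpt : (1 / 2 : ℝ) • (2 * α) • u + (1 / 2 : ℝ) • (2 * α) • v = α • (u + v) := by
      rw [smul_smul, smul_smul, smul_add]
      congr 2 <;> ring
    rw [hpt, h1, EReal.coe_le_coe_iff] at key
    simp only [q, Function.comp]
    rw [← add_div, div_le_div_iff₀ hα (by positivity)]
    nlinarith

namespace IsSublinearDeriv

variable {K : ℝ} {p : X → ℝ}

theorem continuous (hp : IsSublinearDeriv f x K p) (hK : 0 ≤ K) : Continuous p := by
  refine (LipschitzWith.of_le_add_mul K.toNNReal fun u v => ?_).continuous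
  have h := hp.subadditive v (u - v)
  rw [add_sub_cancel] at h
  rw [Real.coe_toNNReal K hK, dist_eq_norm]
  linarith [hp.bound (u - v)]

theorem lowerSemicontinuous_dirDeriv (hp : IsSublinearDeriv f x K p) (hK : 0 ≤ K) :
    LowerSemicontinuous (dirDeriv f x) := by
  have : dirDeriv f x = fun u => (p u : EReal) := funext hp.dirDeriv_eq
  rw [this]
  exact (continuous_coe_real_ereal.comp (hp.continuous hK)).lowerSemicontinuous

/-- By convexity, the quotients at steps `α ≤ 1` are bounded by the one at step `1`. -/
theorem le_sub (hp : IsSublinearDeriv f x K p) (hf : IsClosedConvex f) {r a : ℝ} (hr : f x = r)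
    {u : X} (hu : f (x + u) = a) : p u ≤ a - r := by
  refine le_of_tendsto (hp.tendsto u) ?_
  filter_upwards [hp.eventually_real u, self_mem_nhdsWithin,
    mem_nhdsWithin_of_mem_nhds (Iic_mem_nhds one_pos)] with α h hα h1
  have hα : (0 : ℝ) < α := hα
  have := hf.le_smul hr hu.le hα.le h1
  rw [h, EReal.coe_le_coe_iff] at this
  rw [hr, EReal.toReal_coe, div_le_iff₀ hα]
  linarith

/-! ### Duality: Hahn–Banach and Banach–Alaoglu -/

/-- The subdifferential consists of the functionals dominated by the directional derivative. -/
theorem mem_subdiff_iff (hp : IsSublinearDeriv f x K p) (hf : IsClosedConvex f) {r : ℝ}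
    (hr : f x = r) {φ : WeakDual ℝ X} : φ ∈ subdiff f x ↔ ∀ u, φ u ≤ p u := by
  refine ⟨fun h u => ?_, fun h y => ?_⟩
  · refine ge_of_tendsto (hp.tendsto u) ?_
    filter_upwards [hp.eventually_real u, self_mem_nhdsWithin] with α h1 hα
    have hα : (0 : ℝ) < α := hα
    have := h (x + α • u)
    rw [h1, hr, add_sub_cancel_left, ← EReal.coe_add, EReal.coe_le_coe_iff, map_smul,
      smul_eq_mul] at this
    rw [hr, EReal.toReal_coe, le_div_iff₀ hα]
    linarith
  · induction hy : f y with
    | bot => exact absurd hy (hf.ne_bot y)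
    | top => exact le_top
    | coe a =>
      have hy' : f (x + (y - x)) = a := by rw [add_sub_cancel, hy]
      rw [hr, ← EReal.coe_add, EReal.coe_le_coe_iff]
      linarith [h (y - x), hp.le_sub hf hr hy']

theorem map_zero (hp : IsSublinearDeriv f x K p) : p 0 = 0 := by
  have := hp.homogeneous 2 two_pos 0
  rw [smul_zero] at this
  linarith

/-- The directional derivative is the support function of the subdifferential, and the supremum is
attained. -/
theorem exists_mem_subdiff_eq (hp : IsSublinearDeriv f x K p) (hf : IsClosedConvex f) {r : ℝ}
    (hr : f x = r) (u : X) : ∃ φ ∈ subdiff f x, φ u = p u := by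
  have hex : ∃ g : X →ₗ[ℝ] ℝ, g u = p u ∧ ∀ v, g v ≤ p v := by
    rcases eq_or_ne u 0 with rfl | hu
    · obtain ⟨g, -, hg⟩ := exists_extension_of_le_sublinear (⊥ : X →ₗ.[ℝ] ℝ) p hp.homogeneous
        hp.subadditive (fun v => by
          have : (v : X) = 0 := (Submodule.mem_bot ℝ).1 v.2
          have hv : v = 0 := Subtype.ext this
          rw [hv, LinearPMap.map_zero, ZeroMemClass.coe_zero, hp.map_zero])
      exact ⟨g, by rw [LinearMap.map_zero, hp.map_zero], hg⟩
    · obtain ⟨g, hg1, hg2⟩ := exists_extension_of_le_sublinear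
        (LinearPMap.mkSpanSingleton (K := ℝ) u (p u) hu) p hp.homogeneous hp.subadditive
        (fun ⟨v, hv⟩ => by
          obtain ⟨t, rfl⟩ := Submodule.mem_span_singleton.1 hv
          refine (LinearPMap.mkSpanSingleton'_apply u (p u) _ t hv).trans_le ?_
          rw [smul_eq_mul]
          rcases lt_trichotomy t 0 with ht | rfl | ht
          -- For `t < 0`, `0 = p 0 ≤ p (t • u) + (-t) * p u` is the required domination.
          · have h1 := hp.subadditive (t • u) ((-t) • u)
            rw [← add_smul, add_neg_cancel, zero_smul, hp.map_zero,
              hp.homogeneous (-t) (neg_pos.2 ht)] at h1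
            change t * p u ≤ p (t • u)
            linarith
          · simp [hp.map_zero]
          · exact (hp.homogeneous t ht u).ge)
      refine ⟨g, ?_, hg2⟩
      have := hg1 ⟨u, Submodule.mem_span_singleton_self u⟩
      rw [this]
      exact LinearPMap.mkSpanSingleton_apply ℝ ℝ hu (p u)
  obtain ⟨g, hgu, hg⟩ := hex
  let φ : X →L[ℝ] ℝ := g.mkContinuous K fun v => by
    rw [Real.norm_eq_abs]
    refine abs_le.2 ⟨?_, (hg v).trans (hp.bound v)⟩
    have := (hg (-v)).trans (hp.bound (-v))
    rw [_root_.map_neg, norm_neg] at this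
    linarith
  exact ⟨StrongDual.toWeakDual φ, (hp.mem_subdiff_iff hf hr).2 hg, hgu⟩

/-- An intersection of weak* closed half-spaces, contained in the dual ball of radius `K`. -/
theorem isCompact_subdiff (hp : IsSublinearDeriv f x K p) (hf : IsClosedConvex f) (hK : 0 ≤ K)
    {r : ℝ} (hr : f x = r) : IsCompact (subdiff f x) := by
  refine (WeakDual.isCompact_closedBall (𝕜 := ℝ) (E := X) 0 K).of_isClosed_subset ?_ ?_
  · have : subdiff f x = ⋂ u, {φ : WeakDual ℝ X | φ u ≤ p u} := by
      ext φ
      simp [hp.mem_subdiff_iff hf hr]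
    rw [this]
    exact isClosed_iInter fun u => isClosed_le (WeakDual.eval_continuous u) continuous_const
  · intro φ hφ
    have h := (hp.mem_subdiff_iff hf hr).1 hφ
    rw [mem_preimage, mem_closedBall_zero_iff]
    refine ContinuousLinearMap.opNorm_le_bound _ hK fun v => ?_
    rw [Real.norm_eq_abs]
    refine abs_le.2 ⟨?_, (h v).trans (hp.bound v)⟩
    have := (h (-v)).trans (hp.bound (-v))
    rw [_root_.map_neg, norm_neg] at this
    change -(K * ‖v‖) ≤ φ v
    linarith

theorem maxAffine_eq (hp : IsSublinearDeriv f x K p) (hf : IsClosedConvex f) {r : ℝ}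
    (hr : f x = r) {α : ℝ} (hα : 0 ≤ α) (u : X) :
    maxAffine ({0} ×ˢ subdiff f x) α u = α * p u := by
  refine IsGreatest.csSup_eq ⟨?_, ?_⟩
  · obtain ⟨φ, hφ, hu⟩ := hp.exists_mem_subdiff_eq hf hr u
    exact ⟨(0, φ), ⟨rfl, hφ⟩, by simp [hu]⟩
  · rintro _ ⟨⟨a, φ⟩, ⟨ha, hφ⟩, rfl⟩
    have ha : a = 0 := ha
    subst ha
    simpa using mul_le_mul_of_nonneg_left ((hp.mem_subdiff_iff hf hr).1 hφ u) hα

/-- `{0} × ∂f(x)` is a hypodifferential. -/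
theorem isHypodifferential (hp : IsSublinearDeriv f x K p) (hf : IsClosedConvex f) (hK : 0 ≤ K)
    {r : ℝ} (hr : f x = r) : IsHypodifferential f x ({0} ×ˢ subdiff f x) where
  isCompact := isCompact_singleton.prod (hp.isCompact_subdiff hf hK hr)
  tendsto u := by
    have h0 : Tendsto (fun α : ℝ => ENNReal.ofReal
        |((f (x + α • u)).toReal - (f x).toReal) / α - p u|) (𝓝[>] 0) (𝓝 0) := by
      have := ((hp.tendsto u).sub_const (p u)).abs
      rw [sub_self, abs_zero] at this
      simpa using ENNReal.tendsto_ofReal this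
    refine h0.congr' ?_
    filter_upwards [hp.eventually_real u, self_mem_nhdsWithin] with α h hα
    have hα : (0 : ℝ) < α := hα
    rw [hp.maxAffine_eq hf hr hα.le, h, hr, ← EReal.coe_sub, ← EReal.coe_sub, EReal.abs_def,
      ← ENNReal.ofReal_div_of_pos hα, EReal.toReal_coe, EReal.toReal_coe]
    congr 1
    rw [← abs_of_pos hα, ← abs_div, abs_of_pos hα]
    congr 1
    field_simp
  max_eq_zero := by
    obtain ⟨φ, hφ, -⟩ := hp.exists_mem_subdiff_eq hf hr 0
    refine ⟨⟨(0, φ), ⟨rfl, hφ⟩, rfl⟩, ?_⟩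
    rintro _ ⟨⟨a, ψ⟩, ⟨ha, -⟩, rfl⟩
    exact (show a = 0 from ha).le

end IsSublinearDeriv

/-! ### Necessity of the core condition -/

theorem IsHypodifferential.mem_core {H : Set (ℝ × WeakDual ℝ X)} (hH : IsHypodifferential f x H)
    (hf : IsClosedConvex f) (hx : x ∈ dom f) : x ∈ core (dom f) := by
  refine ⟨hx, fun u => ?_⟩
  have hev : ∀ᶠ α : ℝ in 𝓝[>] 0, x + α • u ∈ dom f := by
    -- Where `f (x + α • u) = ⊤` the quotient is `⊤`, which a limit of `0` rules out for small `α`.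
    filter_upwards [(hH.tendsto u).eventually_lt_const ENNReal.zero_lt_top] with α h
    obtain ⟨r, hr⟩ := hx
    induction hy : f (x + α • u) with
    | bot => exact absurd hy (hf.ne_bot _)
    | top =>
      rw [hy, hr, EReal.top_sub_coe, EReal.top_sub_coe, EReal.abs_top,
        ENNReal.top_div_of_ne_top ENNReal.ofReal_ne_top] at h
      exact absurd h (lt_irrefl _)
    | coe a => exact ⟨a, hy⟩
  obtain ⟨τ, hτ, h⟩ := mem_nhdsGT_iff_exists_Ioc_subset.1 hev
  refine ⟨τ, hτ, fun t ht => ?_⟩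
  rcases ht.1.eq_or_lt with rfl | h0
  · simpa using hx
  · exact h ⟨h0, ht.2⟩

end Hypodiff

theorem mainTheorem10 {X : Type*} [NormedAddCommGroup X] [NormedSpace ℝ X] [CompleteSpace X]
    (f : X → EReal) (hf : Hypodiff.IsClosedConvex f) (x : X) (hx : x ∈ Hypodiff.dom f) :
    (Hypodiff.HypodifferentiableAt f x ↔
      x ∈ Hypodiff.core (Hypodiff.dom f) ∧
      (Hypodiff.subdiff f x).Nonempty ∧
      IsCompact (Hypodiff.subdiff f x) ∧
      LowerSemicontinuous (Hypodiff.dirDeriv f x)) ∧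
    (FiniteDimensional ℝ X →
      (x ∈ Hypodiff.core (Hypodiff.dom f) → LowerSemicontinuous (Hypodiff.dirDeriv f x)) ∧
      (Hypodiff.HypodifferentiableAt f x ↔
        x ∈ Hypodiff.core (Hypodiff.dom f) ∧
        (Hypodiff.subdiff f x).Nonempty ∧
        IsCompact (Hypodiff.subdiff f x))) := by
  -- On a Banach space, membership in the core of the domain already implies everything else.
  have hcore : x ∈ Hypodiff.core (Hypodiff.dom f) →
      Hypodiff.HypodifferentiableAt f x ∧ (Hypodiff.subdiff f x).Nonempty ∧
      IsCompact (Hypodiff.subdiff f x) ∧ LowerSemicontinuous (Hypodiff.dirDeriv f x) := by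
    intro h
    obtain ⟨δ, hδ, M, hM⟩ := hf.exists_le_of_mem_core h
    obtain ⟨K, p, hK, hp⟩ := hf.exists_isSublinearDeriv hx hδ hM
    obtain ⟨r, hr⟩ := hx
    obtain ⟨φ, hφ, -⟩ := hp.exists_mem_subdiff_eq hf hr 0
    exact ⟨⟨_, hp.isHypodifferential hf hK hr⟩, ⟨φ, hφ⟩, hp.isCompact_subdiff hf hK hr,
      hp.lowerSemicontinuous_dirDeriv hK⟩
  have hmem : Hypodiff.HypodifferentiableAt f x → x ∈ Hypodiff.core (Hypodiff.dom f) :=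
    fun ⟨_, hH⟩ => hH.mem_core hf hx
  refine ⟨⟨fun h => ⟨hmem h, (hcore (hmem h)).2⟩, fun h => (hcore h.1).1⟩, fun _ =>
    ⟨fun h => (hcore h).2.2.2, fun h => ?_, fun h => (hcore h.1).1⟩⟩
  exact ⟨hmem h, (hcore (hmem h)).2.1, (hcore (hmem h)).2.2.1⟩
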